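/- Let $(X,d)$ be a complete proper geodesic metric space (proper: closed bounded subsets are compact; geodesic: any two points are joined by a curve of length equal to their distance), let $\Omega\subset X$ be open, and let $H:\Omega\times\mathbb R\times[0,\infty)\to\mathbb R$ be continuous and coercive, i.e. $$\inf_{(x,\rho)\in\Omega\times[-R,R]}H(x,\rho,p)\to\infty\quad\text{as }p\to\infty,\ \text{for every }R>0.$$ Assume that for every $(x,\rho)\in\Omega\times\mathbb R$ the map $p\mapsto H(x,\rho,p)$ is strictly increasing on $(0,\infty)$. For a locally Lipschitz function $u$ on $\Omega$ (written $u\in\mathrm{Lip}_{loc}(\Omega)$) put $$|\nabla u|(x)=\limsup_{y\to x}\frac{|u(y)-u(x)|}{d(x,y)},\qquad |\nabla^{\pm}u|(x)=\limsup_{y\to x}\frac{[u(y)-u(x)]_{\pm}}{d(x,y)},\qquad |\nabla u|^*(x)=\limsup_{y\to x}|\nabla u|(y),$$ where $[a]_+=\max\{a,0\}$ and $[a]_-=\max\{-a,0\}$ (the limsups of difference quotients are read as $0$ at an isolated point, and $|\nabla u|^*$ is the upper semicontinuous envelope of $|\nabla u|$). Let $\overline{\mathcal C}(\Omega)$ (resp.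 $\underline{\mathcal C}(\Omega)$) be the set of $\psi\in\mathrm{Lip}_{loc}(\Omega)$ such that $|\nabla^+\psi|=|\nabla\psi|$ (resp. $|\nabla^-\psi|=|\nabla\psi|$) in $\Omega$ and $|\nabla\psi|$ is continuous in $\Omega$. For $a\ge0$ and $p\ge 0$ put $$H_a(x,\rho,p)=\inf_{q\ge0,\,|q-p|\le a}H(x,\rho,q),\qquad H^a(x,\rho,p)=\sup_{q\ge0,\,|q-p|\le a}H(x,\rho,q).$$ A function $u:\Omega\to\mathbb R$ is a Monge solution of $H(x,u,|\nabla u|)=0$ in $\Omega$ if $u\in\mathrm{Lip}_{loc}(\Omega)$ and $H(x,u(x),|\nabla^-u|(x))=0$ for every $x\in\Omega$. It is an s-solution if it is continuous in $\Omega$ and * $H_{|\nabla\psi_2|^*(x)}(x,u(x),|\nabla\psi_1|(x))\le0$ whenever $\psi_1\in\underline{\mathcal C}(\Omega)$, $\psi_2\in\mathrm{Lip}_{loc}(\Omega)$ and $u-\psi_1-\psi_2$ has a local maximum at $x\in\Omega$; * $H^{|\nabla\psi_2|^*(x)}(x,u(x),|\nabla\psi_1|(x))\ge0$ whenever $\psi_1\in\overline{\mathcal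 C}(\Omega)$, $\psi_2\in\mathrm{Lip}_{loc}(\Omega)$ and $u-\psi_1-\psi_2$ has a local minimum at $x\in\Omega$. Then a function $u:\Omega\to\mathbb R$ is a Monge solution of $H(x,u,|\nabla u|)=0$ in $\Omega$ if and only if it is an s-solution. In addition, every such $u$ is locally Lipschitz in $\Omega$. -/

import Mathlib

open Set Filter Topology

namespace MetricHJ

/-- A geodesic space: any two points are joined by a curve, parametrized by arc length on
`[0, d(x, y)]`, which realizes the distance. -/
def IsGeodesicSpace (X : Type*) [MetricSpace X] : Prop :=
  ∀ x y : X, ∃ γ : ℝ → X, γ 0 = x ∧ γ (dist x y) = y ∧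
    ∀ s ∈ Icc (0 : ℝ) (dist x y), ∀ t ∈ Icc (0 : ℝ) (dist x y), dist (γ s) (γ t) = |s - t|

noncomputable section

variable {X : Type*} [MetricSpace X]

/-- The local slope `|∇u|(x) = limsup_{y → x, y ≠ x} |u(y) - u(x)| / d(x, y)`. It is used only for
functions that are Lipschitz near `x`, for which the quotients are bounded. -/
def slope (u : X → ℝ) (x : X) : ℝ :=
  limsup (fun y => |u y - u x| / dist x y) (𝓝[≠] x)

/-- The super-slope `|∇⁺u|(x) = limsup_{y → x} [u(y) - u(x)]₊ / d(x, y)`. -/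
def superSlope (u : X → ℝ) (x : X) : ℝ :=
  limsup (fun y => max (u y - u x) 0 / dist x y) (𝓝[≠] x)

/-- The sub-slope `|∇⁻u|(x) = limsup_{y → x} [u(y) - u(x)]₋ / d(x, y)`. -/
def subSlope (u : X → ℝ) (x : X) : ℝ :=
  limsup (fun y => max (u x - u y) 0 / dist x y) (𝓝[≠] x)

/-- The upper semicontinuous envelope `|∇ψ|*(x) = limsup_{y → x} |∇ψ|(y)` of the local slope. -/
def slopeUpper (ψ : X → ℝ) (x : X) : ℝ :=
  limsup (fun y => slope ψ y) (𝓝 x)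

/-- The class of locally Lipschitz functions on `Ω` with `|∇⁺ψ| = |∇ψ|` in `Ω` and `|∇ψ|`
continuous in `Ω`: the test functions for supersolutions. -/
def UpperTestClass (Ω : Set X) (ψ : X → ℝ) : Prop :=
  LocallyLipschitzOn Ω ψ ∧ (∀ x ∈ Ω, superSlope ψ x = slope ψ x) ∧ ContinuousOn (slope ψ) Ω

/-- The class of locally Lipschitz functions on `Ω` with `|∇⁻ψ| = |∇ψ|` in `Ω` and `|∇ψ|`
continuous in `Ω`: the test functions for subsolutions. -/
def LowerTestClass (Ω : Set X) (ψ : X → ℝ) : Prop :=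
  LocallyLipschitzOn Ω ψ ∧ (∀ x ∈ Ω, subSlope ψ x = slope ψ x) ∧ ContinuousOn (slope ψ) Ω

/-- `H_a(x, ρ, p)`, the infimum of `H(x, ρ, q)` over `|q - p| ≤ a`, with `q` in the domain `[0, ∞)`
of the Hamiltonian. -/
def lowerHam (H : X → ℝ → ℝ → ℝ) (a : ℝ) (x : X) (ρ p : ℝ) : ℝ :=
  sInf ((fun q => H x ρ q) '' {q | 0 ≤ q ∧ |q - p| ≤ a})

/-- `H^a(x, ρ, p)`, the supremum of `H(x, ρ, q)` over `|q - p| ≤ a`, with `q` in the domain `[0, ∞)`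
of the Hamiltonian. -/
def upperHam (H : X → ℝ → ℝ → ℝ) (a : ℝ) (x : X) (ρ p : ℝ) : ℝ :=
  sSup ((fun q => H x ρ q) '' {q | 0 ≤ q ∧ |q - p| ≤ a})

/-- Slope-based viscosity subsolutions of `H(x, u, |∇u|) = 0` in `Ω`. -/
def IsSSubsolution (Ω : Set X) (H : X → ℝ → ℝ → ℝ) (u : X → ℝ) : Prop :=
  UpperSemicontinuousOn u Ω ∧
    ∀ ψ₁ ψ₂ : X → ℝ, LowerTestClass Ω ψ₁ → LocallyLipschitzOn Ω ψ₂ →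
      ∀ x ∈ Ω, IsLocalMaxOn (fun y => u y - ψ₁ y - ψ₂ y) Ω x →
        lowerHam H (slopeUpper ψ₂ x) x (u x) (slope ψ₁ x) ≤ 0

/-- Slope-based viscosity supersolutions of `H(x, u, |∇u|) = 0` in `Ω`. -/
def IsSSupersolution (Ω : Set X) (H : X → ℝ → ℝ → ℝ) (u : X → ℝ) : Prop :=
  LowerSemicontinuousOn u Ω ∧
    ∀ ψ₁ ψ₂ : X → ℝ, UpperTestClass Ω ψ₁ → LocallyLipschitzOn Ω ψ₂ →
      ∀ x ∈ Ω, IsLocalMinOn (fun y => u y - ψ₁ y - ψ₂ y) Ω x →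
        0 ≤ upperHam H (slopeUpper ψ₂ x) x (u x) (slope ψ₁ x)

/-- Slope-based viscosity solutions (s-solutions) of `H(x, u, |∇u|) = 0` in `Ω`. -/
def IsSSolution (Ω : Set X) (H : X → ℝ → ℝ → ℝ) (u : X → ℝ) : Prop :=
  ContinuousOn u Ω ∧ IsSSubsolution Ω H u ∧ IsSSupersolution Ω H u

/-- Monge subsolutions of `H(x, u, |∇u|) = 0` in `Ω`. -/
def IsMongeSubsolution (Ω : Set X) (H : X → ℝ → ℝ → ℝ) (u : X → ℝ) : Prop :=
  LocallyLipschitzOn Ω u ∧ ∀ x ∈ Ω, H x (u x) (subSlope u x) ≤ 0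

/-- Monge supersolutions of `H(x, u, |∇u|) = 0` in `Ω`. -/
def IsMongeSupersolution (Ω : Set X) (H : X → ℝ → ℝ → ℝ) (u : X → ℝ) : Prop :=
  LocallyLipschitzOn Ω u ∧ ∀ x ∈ Ω, 0 ≤ H x (u x) (subSlope u x)

/-- Monge solutions of `H(x, u, |∇u|) = 0` in `Ω`. -/
def IsMongeSolution (Ω : Set X) (H : X → ℝ → ℝ → ℝ) (u : X → ℝ) : Prop :=
  IsMongeSubsolution Ω H u ∧ IsMongeSupersolution Ω H u

/-- Coercivity: for every `R > 0`, the infimum of `H(x, ρ, p)` over `(x, ρ) ∈ Ω × [-R, R]`, taken in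
the extended reals, tends to `∞` as `p → ∞`. -/
def IsCoercive (Ω : Set X) (H : X → ℝ → ℝ → ℝ) : Prop :=
  ∀ R : ℝ, 0 < R →
    Tendsto (fun p : ℝ => ⨅ x ∈ Ω, ⨅ ρ ∈ Icc (-R) R, (H x ρ p : EReal)) atTop (𝓝 ⊤)

end

end MetricHJ

/-! From Monge to s-solution, one compares slopes at a touching point: at a maximum of `u - ψ₁ - ψ₂`
the slope of `ψ₁` is at most `subSlope u + slope ψ₂`, at a minimum `subSlope u` is at most `slope ψ₁
+ slope ψ₂`, and monotonicity of `H` in the momentum concludes.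

Conversely, `ψ₂ = 0` and cones suffice. The cone `M d(z, ·)` has slope `M` off its vertex but is
smoothed there into `profile`, whose slope is a continuous function of the distance
(`slope_comp_dist`, where geodesics enter). For a subsolution with `H > 0` at all momenta above `m <
M`, a maximum of `u` minus the cone must sit near the vertex, so `u y - u z ≤ M d + K d²`
(`IsSSubsolution.sub_le_of_pos`). Coercivity turns this into local Lipschitz continuity; letting `z
→ x` with `y = x` bounds `subSlope u x` by `M`, contradicting `H > 0` at the sub-slope. For a
supersolution with `H < 0` at the sub-slope, a cone slightly steeper than it touches `u` from below
near `x` where `H` is still negative. -/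

namespace MetricHJ

/-! ### Limits superior of nonnegative quotients. -/

theorem limsup_nonneg_of_nonneg {α : Type*} {F : Filter α} {q : α → ℝ} (hq : ∀ y, 0 ≤ q y) :
    0 ≤ limsup q F := by
  rcases F.eq_or_neBot with rfl | hF
  · simp [limsup, limsSup]
  · rw [limsup_eq]
    refine Real.sInf_nonneg fun a ha => ?_
    obtain ⟨y, hy⟩ := Eventually.exists (show ∀ᶠ n in F, q n ≤ a from ha)
    exact (hq y).trans hy

/-- Nonnegativity of `c` covers the trivial filter (an isolated point), where the real `limsup` is
`0`. -/
theorem limsup_le_of_forall_add {α : Type*} {F : Filter α} {q : α → ℝ} {c : ℝ}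
    (hq : ∀ y, 0 ≤ q y) (hc : 0 ≤ c) (h : ∀ η > 0, ∀ᶠ y in F, q y ≤ c + η) :
    limsup q F ≤ c := by
  rcases F.eq_or_neBot with rfl | hF
  · simpa [limsup, limsSup] using hc
  · refine le_of_forall_pos_le_add fun η hη => ?_
    exact limsup_le_of_le (isCoboundedUnder_le_of_le F hq) (h η hη)

/-- The bound `hb` keeps the real `limsup` from being a default value; local Lipschitz continuity
will supply it. -/
theorem eventually_le_limsup_add {α : Type*} {F : Filter α} {q : α → ℝ} {L : ℝ}
    (hb : ∀ᶠ y in F, q y ≤ L) {η : ℝ} (hη : 0 < η) : ∀ᶠ y in F, q y ≤ limsup q F + η :=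
  (eventually_lt_of_limsup_lt (lt_add_of_pos_right _ hη) (isBoundedUnder_of_eventually_le hb)).mono
    fun _ h => h.le

/-! ### Slopes of locally Lipschitz functions. -/

variable {X : Type*} [MetricSpace X]

theorem slope_nonneg (u : X → ℝ) (x : X) : 0 ≤ slope u x :=
  limsup_nonneg_of_nonneg fun _ => by positivity

theorem subSlope_nonneg (u : X → ℝ) (x : X) : 0 ≤ subSlope u x :=
  limsup_nonneg_of_nonneg fun _ => by positivity

theorem slope_neg (u : X → ℝ) (x : X) : slope (fun y => -u y) x = slope u x := by
  unfold slope
  congr 1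
  ext y
  rw [← abs_neg]
  ring_nf

theorem superSlope_neg (u : X → ℝ) (x : X) : superSlope (fun y => -u y) x = subSlope u x := by
  unfold superSlope subSlope
  congr 1
  ext y
  ring_nf

theorem eventually_abs_sub_le {Ω : Set X} (hΩ : IsOpen Ω) {u : X → ℝ}
    (hu : LocallyLipschitzOn Ω u) {x : X} (hx : x ∈ Ω) :
    ∃ L : ℝ, 0 ≤ L ∧ ∀ᶠ y in 𝓝 x, ∀ᶠ z in 𝓝 y, |u z - u y| ≤ L * dist y z := by
  obtain ⟨L, t, ht, hL⟩ := hu hx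
  rw [hΩ.nhdsWithin_eq hx] at ht
  refine ⟨L, L.2, ?_⟩
  filter_upwards [eventually_eventually_nhds.2 ht] with y hy
  filter_upwards [hy] with z hz
  have := hL.dist_le_mul z hz y (mem_of_mem_nhds hy)
  rwa [Real.dist_eq, dist_comm z y] at this

theorem slope_le_of_eventually {u : X → ℝ} {x : X} {L : ℝ} (hL : 0 ≤ L)
    (h : ∀ᶠ z in 𝓝 x, |u z - u x| ≤ L * dist x z) : slope u x ≤ L := by
  refine limsup_le_of_forall_add (fun _ => by positivity) hL fun η hη => ?_
  filter_upwards [nhdsWithin_le_nhds h] with y hy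
  exact (div_le_of_le_mul₀ dist_nonneg hL hy).trans (by linarith)

theorem slope_le_slopeUpper {Ω : Set X} (hΩ : IsOpen Ω) {u : X → ℝ}
    (hu : LocallyLipschitzOn Ω u) {x : X} (hx : x ∈ Ω) : slope u x ≤ slopeUpper u x := by
  obtain ⟨L, hL, h⟩ := eventually_abs_sub_le hΩ hu hx
  refine le_limsup_of_frequently_le ?_ (isBoundedUnder_of_eventually_le (a := L)
    (h.mono fun y hy => slope_le_of_eventually hL hy))
  -- The envelope is taken along the full filter `𝓝 x`, so the value at `x` itself counts.
  exact Frequently.filter_mono (f := pure x) (by simp) (pure_le_nhds x)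

theorem eventually_abs_sub_le_slope {Ω : Set X} (hΩ : IsOpen Ω) {u : X → ℝ}
    (hu : LocallyLipschitzOn Ω u) {x : X} (hx : x ∈ Ω) {η : ℝ} (hη : 0 < η) :
    ∀ᶠ y in 𝓝[≠] x, |u y - u x| ≤ (slope u x + η) * dist x y := by
  obtain ⟨L, hL, h⟩ := eventually_abs_sub_le hΩ hu hx
  have hb : ∀ᶠ y in 𝓝[≠] x, |u y - u x| / dist x y ≤ L :=
    nhdsWithin_le_nhds (h.self_of_nhds.mono fun y hy => div_le_of_le_mul₀ dist_nonneg hL hy)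
  filter_upwards [eventually_le_limsup_add hb hη, self_mem_nhdsWithin] with y hy hne
  exact (div_le_iff₀ (dist_pos.2 (Ne.symm hne))).1 hy

theorem eventually_sub_le_subSlope {Ω : Set X} (hΩ : IsOpen Ω) {u : X → ℝ}
    (hu : LocallyLipschitzOn Ω u) {x : X} (hx : x ∈ Ω) {η : ℝ} (hη : 0 < η) :
    ∀ᶠ y in 𝓝[≠] x, u x - u y ≤ (subSlope u x + η) * dist x y := by
  obtain ⟨L, hL, h⟩ := eventually_abs_sub_le hΩ hu hx
  have hb : ∀ᶠ y in 𝓝[≠] x, max (u x - u y) 0 / dist x y ≤ L :=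
    nhdsWithin_le_nhds (h.self_of_nhds.mono fun y hy => div_le_of_le_mul₀ dist_nonneg hL
      (max_le ((neg_sub (u y) (u x) ▸ neg_le_abs _).trans hy) (by positivity)))
  filter_upwards [eventually_le_limsup_add hb hη, self_mem_nhdsWithin] with y hy hne
  exact (le_max_left _ _).trans ((div_le_iff₀ (dist_pos.2 (Ne.symm hne))).1 hy)

theorem subSlope_le_of_eventually {u : X → ℝ} {x : X} {c : ℝ} (hc : 0 ≤ c)
    (h : ∀ η > 0, ∀ᶠ y in 𝓝[≠] x, u x - u y ≤ (c + η) * dist x y) : subSlope u x ≤ c := by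
  refine limsup_le_of_forall_add (fun _ => by positivity) hc fun η hη => ?_
  filter_upwards [h η hη] with y hy
  exact div_le_of_le_mul₀ dist_nonneg (by positivity) (max_le hy (by positivity))

theorem slopeUpper_zero (x : X) : slopeUpper (fun _ => (0 : ℝ)) x = 0 := by
  have h : ∀ y : X, slope (fun _ => (0 : ℝ)) y = 0 := fun y =>
    le_antisymm (slope_le_of_eventually le_rfl (by simp)) (slope_nonneg _ _)
  simp [slopeUpper, h]

theorem lowerHam_zero {X : Type*} (H : X → ℝ → ℝ → ℝ) (x : X) (ρ : ℝ) {p : ℝ} (hp : 0 ≤ p) :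
    lowerHam H 0 x ρ p = H x ρ p := by
  have : {q : ℝ | 0 ≤ q ∧ |q - p| ≤ 0} = {p} := by
    ext q
    simp only [mem_ofPred_eq, abs_nonpos_iff, sub_eq_zero, mem_singleton_iff]
    exact ⟨fun h => h.2, fun h => ⟨h ▸ hp, h⟩⟩
  rw [lowerHam, this, image_singleton, csInf_singleton]

theorem upperHam_zero {X : Type*} (H : X → ℝ → ℝ → ℝ) (x : X) (ρ : ℝ) {p : ℝ} (hp : 0 ≤ p) :
    upperHam H 0 x ρ p = H x ρ p := by
  have : {q : ℝ | 0 ≤ q ∧ |q - p| ≤ 0} = {p} := by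
    ext q
    simp only [mem_ofPred_eq, abs_nonpos_iff, sub_eq_zero, mem_singleton_iff]
    exact ⟨fun h => h.2, fun h => ⟨h ▸ hp, h⟩⟩
  rw [upperHam, this, image_singleton, csSup_singleton]

/-! ### Radial test functions. -/

/-- The slope, and also the sub-slope, of an increasing `C¹` function of the distance to a point. -/
theorem slope_comp_dist (hX : IsGeodesicSpace X) {f f' : ℝ → ℝ}
    (hf : ∀ t, 0 ≤ t → HasDerivAt f (f' t) t) (hf' : ∀ t, 0 ≤ t → 0 ≤ f' t) (h0 : f' 0 = 0)
    (z x : X) :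
    slope (fun y => f (dist z y)) x = f' (dist z x) ∧
      subSlope (fun y => f (dist z y)) x = f' (dist z x) := by
  have hup : ∀ η > 0, ∀ᶠ y in 𝓝 x,
      |f (dist z y) - f (dist z x)| ≤ (f' (dist z x) + η) * dist x y := by
    intro η hη
    have hd := (hf (dist z x) dist_nonneg).isLittleO.def hη
    have hc : Tendsto (fun y => dist z y) (𝓝 x) (𝓝 (dist z x)) :=
      (continuous_const.dist continuous_id).tendsto x
    filter_upwards [hc.eventually hd] with y hy
    simp only [Real.norm_eq_abs, smul_eq_mul] at hy
    have h1 : |dist z y - dist z x| ≤ dist x y := by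
      rw [dist_comm z y, dist_comm z x, dist_comm x y]
      exact abs_dist_sub_le y x z
    have h2 := abs_sub_abs_le_abs_sub (f (dist z y) - f (dist z x))
      ((dist z y - dist z x) * f' (dist z x))
    rw [abs_mul, abs_of_nonneg (hf' _ dist_nonneg)] at h2
    have h3 := hf' (dist z x) dist_nonneg
    nlinarith
  have hs : slope (fun y => f (dist z y)) x ≤ f' (dist z x) := by
    refine le_of_forall_pos_le_add fun η hη => ?_
    exact slope_le_of_eventually (add_nonneg (hf' _ dist_nonneg) hη.le) (hup η hη)
  have hbd : ∀ᶠ y in 𝓝[≠] x,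
      |f (dist z y) - f (dist z x)| / dist x y ≤ f' (dist z x) + 1 :=
    nhdsWithin_le_nhds ((hup 1 one_pos).mono fun y hy =>
      div_le_of_le_mul₀ dist_nonneg (add_nonneg (hf' _ dist_nonneg) zero_le_one) hy)
  have hle : ∀ y, max (f (dist z x) - f (dist z y)) 0 / dist x y ≤
      |f (dist z y) - f (dist z x)| / dist x y := fun y => by
    gcongr
    exact max_le (neg_sub (f (dist z y)) (f (dist z x)) ▸ neg_le_abs _) (abs_nonneg _)
  have hss : subSlope (fun y => f (dist z y)) x ≤ slope (fun y => f (dist z y)) x := by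
    refine limsup_le_of_forall_add (fun _ => by positivity) (slope_nonneg _ _) fun η hη => ?_
    filter_upwards [eventually_le_limsup_add hbd hη] with y hy
    exact (hle y).trans hy
  have hlow : f' (dist z x) ≤ subSlope (fun y => f (dist z y)) x := by
    -- At the vertex `h0` makes the bound trivial. Elsewhere a geodesic from `x` to `z` decreases
    -- the distance to `z` at unit rate, so the quotients along it tend to `f'`.
    rcases eq_or_ne x z with rfl | hne
    · rw [dist_self, h0]
      exact subSlope_nonneg _ _
    have ht : 0 < dist x z := dist_pos.2 hne
    obtain ⟨γ, hγ0, hγ1, hγ⟩ := hX x z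
    have hx : ∀ h ∈ Icc 0 (dist x z), dist x (γ h) = h := fun h hh => by
      have := hγ 0 ⟨le_rfl, ht.le⟩ h hh
      rwa [hγ0, zero_sub, abs_neg, abs_of_nonneg hh.1] at this
    have hz : ∀ h ∈ Icc 0 (dist x z), dist z (γ h) = dist z x - h := fun h hh => by
      have := hγ _ ⟨ht.le, le_rfl⟩ h hh
      rwa [hγ1, abs_of_nonneg (sub_nonneg.2 hh.2), dist_comm x z] at this
    have hIoo : ∀ᶠ h in 𝓝[>] (0 : ℝ), h ∈ Ioo 0 (dist x z) := Ioo_mem_nhdsGT ht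
    have htend : Tendsto γ (𝓝[>] 0) (𝓝[≠] x) := by
      refine tendsto_nhdsWithin_iff.2 ⟨?_, ?_⟩
      · rw [tendsto_iff_dist_tendsto_zero]
        refine Tendsto.congr' (f₁ := fun h => h) ?_ nhdsWithin_le_nhds
        filter_upwards [hIoo] with h hh
        rw [dist_comm, hx h ⟨hh.1.le, hh.2.le⟩]
      · filter_upwards [hIoo] with h hh
        intro he
        have := hx h ⟨hh.1.le, hh.2.le⟩
        rw [show γ h = x from he, dist_self] at this
        exact hh.1.ne this
    refine le_of_forall_pos_le_add fun η hη => ?_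
    have hev : ∀ᶠ h in 𝓝[>] (0 : ℝ), f' (dist z x) - η ≤
        max (f (dist z x) - f (dist z (γ h))) 0 / dist x (γ h) := by
      have hd := (hf (dist z x) dist_nonneg).isLittleO.def hη
      have hc : Tendsto (fun h => dist z x - h) (𝓝[>] 0) (𝓝 (dist z x)) := by
        have : Tendsto (fun h => dist z x - h) (𝓝 0) (𝓝 (dist z x - 0)) :=
          (continuous_const.sub continuous_id).tendsto 0
        rw [sub_zero] at this
        exact this.mono_left nhdsWithin_le_nhds
      filter_upwards [hc.eventually hd, hIoo] with h hh hI
      rw [hx h ⟨hI.1.le, hI.2.le⟩, hz h ⟨hI.1.le, hI.2.le⟩, le_div_iff₀ hI.1]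
      refine le_trans ?_ (le_max_left _ _)
      simp only [Real.norm_eq_abs, smul_eq_mul, sub_sub_cancel_left, abs_neg,
        abs_of_pos hI.1] at hh
      have := le_of_abs_le hh
      linarith
    have hfr := htend.frequently (p := fun y => f' (dist z x) - η ≤
      max (f (dist z x) - f (dist z y)) 0 / dist x y) hev.frequently
    have := le_limsup_of_frequently_le hfr
      (isBoundedUnder_of_eventually_le (hbd.mono fun y hy => (hle y).trans hy))
    have h2 : f' (dist z x) - η ≤ subSlope (fun y => f (dist z y)) x := this
    linarith
  exact ⟨le_antisymm hs (hlow.trans hss), le_antisymm (hss.trans hs) hlow⟩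

theorem locallyLipschitz_comp_dist {f f' : ℝ → ℝ} (hf : ∀ t, 0 ≤ t → HasDerivAt f (f' t) t)
    (hf'c : ContinuousOn f' (Ici 0)) (z : X) : LocallyLipschitz fun y => f (dist z y) := by
  intro x
  obtain ⟨C, hC⟩ := isCompact_Icc.exists_bound_of_continuousOn
    (hf'c.mono (Icc_subset_Ici_self : Icc 0 (dist z x + 1) ⊆ Ici 0))
  have hL : LipschitzOnWith (Real.toNNReal C) f (Icc 0 (dist z x + 1)) :=
    (convex_Icc _ _).lipschitzOnWith_of_nnnorm_hasDerivWithin_le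
      (fun t ht => (hf t ht.1).hasDerivWithinAt) fun t ht => by
        rw [← NNReal.coe_le_coe, coe_nnnorm]
        exact (hC t ht).trans (Real.le_coe_toNNReal C)
  refine ⟨Real.toNNReal C * 1, Metric.ball x 1, Metric.ball_mem_nhds x one_pos, ?_⟩
  refine hL.comp (LipschitzWith.dist_right z).lipschitzOnWith fun y hy => ⟨dist_nonneg, ?_⟩
  have := dist_triangle z x y
  rw [Metric.mem_ball, dist_comm] at hy
  linarith

/-- Increasing `C¹` functions of the distance to a point with vanishing derivative at `0` are test
functions for subsolutions. -/
theorem lowerTestClass_comp_dist (hX : IsGeodesicSpace X) {f f' : ℝ → ℝ}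
    (hf : ∀ t, 0 ≤ t → HasDerivAt f (f' t) t) (hf' : ∀ t, 0 ≤ t → 0 ≤ f' t) (h0 : f' 0 = 0)
    (hf'c : ContinuousOn f' (Ici 0)) (z : X) (Ω : Set X) :
    LowerTestClass Ω fun y => f (dist z y) := by
  refine ⟨(locallyLipschitz_comp_dist hf hf'c z).locallyLipschitzOn, fun x _ => ?_, ?_⟩
  · rw [(slope_comp_dist hX hf hf' h0 z x).1, (slope_comp_dist hX hf hf' h0 z x).2]
  · rw [show slope (fun y => f (dist z y)) = fun x => f' (dist z x) from
      funext fun x => (slope_comp_dist hX hf hf' h0 z x).1]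
    exact hf'c.comp (continuous_const.dist continuous_id).continuousOn fun _ _ => dist_nonneg

/-- Reflection exchanges the one-sided slopes, so negated cones can test supersolutions. -/
theorem LowerTestClass.neg {Ω : Set X} {ψ : X → ℝ} (h : LowerTestClass Ω ψ) :
    UpperTestClass Ω fun y => -ψ y := by
  refine ⟨fun x hx => ?_, fun x hx => ?_, ?_⟩
  · obtain ⟨K, t, ht, hK⟩ := h.1 hx
    exact ⟨K, t, ht, hK.neg⟩
  · rw [superSlope_neg, slope_neg, h.2.1 x hx]
  · rw [show slope (fun y => -ψ y) = slope ψ from funext (slope_neg ψ)]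
    exact h.2.2

/-! ### The smoothed cone. -/

/-- The profile `M t² / (t + ε) + K t²`: a function with vanishing derivative at `0`, which converges
to `M t + K t²` as `ε → 0`. -/
noncomputable def profile (M ε K t : ℝ) : ℝ := M * (t - ε + ε ^ 2 / (t + ε)) + K * t ^ 2

/-- The derivative of `profile M ε K`. -/
noncomputable def profileDeriv (M ε K t : ℝ) : ℝ := M * (1 - (ε / (t + ε)) ^ 2) + 2 * K * t

section profile

variable {M ε K t : ℝ}

theorem hasDerivAt_profile (hε : 0 < ε) (ht : 0 ≤ t) :
    HasDerivAt (profile M ε K) (profileDeriv M ε K t) t := by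
  have hne : t + ε ≠ 0 := by positivity
  have h1 : HasDerivAt (fun s : ℝ => s + ε) 1 t := (hasDerivAt_id t).add_const ε
  have h2 : HasDerivAt (fun s : ℝ => s - ε) 1 t := (hasDerivAt_id t).sub_const ε
  have h3 := (hasDerivAt_const t (ε ^ 2)).div h1 hne
  have h4 := ((h2.add h3).const_mul M).add (((hasDerivAt_id t).pow 2).const_mul K)
  refine h4.congr_deriv ?_
  simp only [profileDeriv, id]
  field_simp
  ring

theorem profile_zero (hε : 0 < ε) : profile M ε K 0 = 0 := by
  unfold profile
  field_simp
  ring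

theorem profileDeriv_zero (hε : 0 < ε) : profileDeriv M ε K 0 = 0 := by
  unfold profileDeriv
  field_simp
  ring

theorem profile_nonneg (hM : 0 ≤ M) (hε : 0 < ε) (hK : 0 ≤ K) (ht : 0 ≤ t) :
    0 ≤ profile M ε K t := by
  have : t - ε + ε ^ 2 / (t + ε) = t ^ 2 / (t + ε) := by field_simp; ring
  unfold profile
  rw [this]
  positivity

theorem mul_sq_le_profile (hM : 0 ≤ M) (hε : 0 < ε) (ht : 0 ≤ t) :
    K * t ^ 2 ≤ profile M ε K t := by
  have h := profile_nonneg hM hε le_rfl ht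
  unfold profile at h ⊢
  linarith

theorem mul_sub_le_profile (hM : 0 ≤ M) (hε : 0 < ε) (hK : 0 ≤ K) (ht : 0 ≤ t) :
    M * (t - ε) ≤ profile M ε K t := by
  have h : t - ε ≤ t - ε + ε ^ 2 / (t + ε) := by
    have : 0 ≤ ε ^ 2 / (t + ε) := by positivity
    linarith
  have h2 := mul_le_mul_of_nonneg_left h hM
  unfold profile
  nlinarith [mul_nonneg hK (sq_nonneg t)]

theorem profile_le (hM : 0 ≤ M) (hε : 0 < ε) (ht : 0 ≤ t) :
    profile M ε K t ≤ M * t + K * t ^ 2 := by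
  have h : t - ε + ε ^ 2 / (t + ε) ≤ t := by
    have : ε ^ 2 / (t + ε) ≤ ε := by
      rw [div_le_iff₀ (by positivity)]
      nlinarith
    linarith
  have h2 := mul_le_mul_of_nonneg_left h hM
  unfold profile
  linarith

theorem profileDeriv_nonneg (hM : 0 ≤ M) (hε : 0 < ε) (hK : 0 ≤ K) (ht : 0 ≤ t) :
    0 ≤ profileDeriv M ε K t := by
  have h1 : ε / (t + ε) ≤ 1 := div_le_one_of_le₀ (by linarith) (by positivity)
  have h2 : (ε / (t + ε)) ^ 2 ≤ 1 := pow_le_one₀ (by positivity) h1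
  have h3 := mul_nonneg hM (sub_nonneg.2 h2)
  unfold profileDeriv
  positivity

theorem profileDeriv_le (hM : 0 ≤ M) : profileDeriv M ε 0 t ≤ M := by
  unfold profileDeriv
  nlinarith [mul_nonneg hM (sq_nonneg (ε / (t + ε)))]

/-- With smoothing scale `δ c`, the ratio `ε / (t + ε)` is at most `c ≤ 1` once `t ≥ δ`: beyond
distance `δ` the slope is nearly `M`. -/
theorem le_profileDeriv {c δ : ℝ} (hM : 0 ≤ M) (hc : 0 < c) (hc1 : c ≤ 1) (hδ : 0 < δ)
    (hK : 0 ≤ K) (ht : δ ≤ t) : M * (1 - c) ≤ profileDeriv M (δ * c) K t := by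
  have ht0 : 0 < t := hδ.trans_le ht
  have h1 : δ * c / (t + δ * c) ≤ c := by
    rw [div_le_iff₀ (by positivity)]
    nlinarith [mul_pos hδ hc, mul_pos hc hc]
  have h2 : (δ * c / (t + δ * c)) ^ 2 ≤ c := by
    have h0 : 0 ≤ δ * c / (t + δ * c) := by positivity
    nlinarith
  have h3 := mul_le_mul_of_nonneg_left (sub_le_sub_left h2 1) hM
  have h4 : 0 ≤ 2 * K * t := by positivity
  unfold profileDeriv
  linarith

theorem continuousOn_profileDeriv (hε : 0 < ε) : ContinuousOn (profileDeriv M ε K) (Ici 0) := by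
  unfold profileDeriv
  have : ∀ t ∈ Ici (0 : ℝ), t + ε ≠ 0 := fun t ht => (add_pos_of_nonneg_of_pos ht hε).ne'
  fun_prop (disch := assumption)

end profile

/-! ### Testing with a single function, and the Hamiltonian. -/

variable {Ω : Set X} {H : X → ℝ → ℝ → ℝ} {u : X → ℝ}

theorem lowerTestClass_profile (hX : IsGeodesicSpace X) {M ε K : ℝ} (hM : 0 ≤ M) (hε : 0 < ε)
    (hK : 0 ≤ K) (z : X) (Ω : Set X) : LowerTestClass Ω fun y => profile M ε K (dist z y) :=
  lowerTestClass_comp_dist hX (fun _ => hasDerivAt_profile hε)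
    (fun _ => profileDeriv_nonneg hM hε hK) (profileDeriv_zero hε)
    (continuousOn_profileDeriv hε) z Ω

theorem slope_profile (hX : IsGeodesicSpace X) {M ε K : ℝ} (hM : 0 ≤ M) (hε : 0 < ε)
    (hK : 0 ≤ K) (z x : X) :
    slope (fun y => profile M ε K (dist z y)) x = profileDeriv M ε K (dist z x) :=
  (slope_comp_dist hX (fun _ => hasDerivAt_profile hε)
    (fun _ => profileDeriv_nonneg hM hε hK) (profileDeriv_zero hε) z x).1

theorem locallyLipschitzOn_zero (Ω : Set X) : LocallyLipschitzOn Ω fun _ : X => (0 : ℝ) :=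
  (LocallyLipschitz.const 0).locallyLipschitzOn

/-- For `ψ₂ = 0` the momentum window collapses to a point. -/
theorem IsSSubsolution.le_zero_of_isLocalMaxOn (hu : IsSSubsolution Ω H u) {ψ : X → ℝ}
    (hψ : LowerTestClass Ω ψ) {x : X} (hx : x ∈ Ω)
    (hmax : IsLocalMaxOn (fun y => u y - ψ y) Ω x) : H x (u x) (slope ψ x) ≤ 0 := by
  have := hu.2 ψ (fun _ => 0) hψ (locallyLipschitzOn_zero Ω) x hx (by simpa using hmax)
  rwa [slopeUpper_zero, lowerHam_zero _ _ _ (slope_nonneg _ _)] at this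

theorem IsSSupersolution.zero_le_of_isLocalMinOn (hu : IsSSupersolution Ω H u) {ψ : X → ℝ}
    (hψ : UpperTestClass Ω ψ) {x : X} (hx : x ∈ Ω)
    (hmin : IsLocalMinOn (fun y => u y - ψ y) Ω x) : 0 ≤ H x (u x) (slope ψ x) := by
  have := hu.2 ψ (fun _ => 0) hψ (locallyLipschitzOn_zero Ω) x hx (by simpa using hmin)
  rwa [slopeUpper_zero, upperHam_zero _ _ _ (slope_nonneg _ _)] at this

/-- Standing continuity and monotonicity assumptions on the Hamiltonian. -/
structure IsAdmissible (Ω : Set X) (H : X → ℝ → ℝ → ℝ) : Prop where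
  cont : ContinuousOn (fun z : X × ℝ × ℝ => H z.1 z.2.1 z.2.2)
    (Ω ×ˢ (Set.univ : Set ℝ) ×ˢ Set.Ici (0 : ℝ))
  mono : ∀ x ∈ Ω, ∀ ρ : ℝ, StrictMonoOn (fun p : ℝ => H x ρ p) (Set.Ioi 0)

namespace IsAdmissible

theorem continuousOn_momentum (hH : IsAdmissible Ω H) {x : X} (hx : x ∈ Ω) (ρ : ℝ) :
    ContinuousOn (fun p => H x ρ p) (Ici 0) :=
  hH.cont.comp (f := fun p : ℝ => (x, ρ, p)) (by fun_prop) fun _ hp => ⟨hx, mem_univ _, hp⟩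

/-- Continuity carries monotonicity to the endpoint `0`, which is needed because slopes may vanish.
-/
theorem monotoneOn (hH : IsAdmissible Ω H) {x : X} (hx : x ∈ Ω) (ρ : ℝ) :
    MonotoneOn (fun p => H x ρ p) (Ici 0) := by
  intro p hp q hq hpq
  rcases hpq.eq_or_lt with rfl | hlt
  · exact le_rfl
  rcases (show (0 : ℝ) ≤ p from hp).eq_or_lt with rfl | hp0
  · have h := (hH.continuousOn_momentum hx ρ 0 self_mem_Ici).mono_left
      (nhdsWithin_mono 0 Ioi_subset_Ici_self)
    refine le_of_tendsto h ?_
    filter_upwards [Ioo_mem_nhdsGT hlt] with s hs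
    exact (hH.mono x hx ρ hs.1 hlt hs.2).le
  · exact (hH.mono x hx ρ hp0 (hp0.trans hlt) hlt).le

theorem continuousOn_comp (hH : IsAdmissible Ω H) (hu : ContinuousOn u Ω) {p : ℝ} (hp : 0 ≤ p) :
    ContinuousOn (fun y => H y (u y) p) Ω :=
  hH.cont.comp (f := fun y => (y, u y, p)) (by fun_prop) fun _ hy => ⟨hy, mem_univ _, hp⟩

theorem bddBelow_image (hH : IsAdmissible Ω H) {x : X} (hx : x ∈ Ω) (ρ a p : ℝ) :
    BddBelow ((fun q => H x ρ q) '' {q | 0 ≤ q ∧ |q - p| ≤ a}) := by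
  refine ⟨H x ρ 0, ?_⟩
  rintro _ ⟨q, hq, rfl⟩
  exact hH.monotoneOn hx ρ self_mem_Ici hq.1 hq.1

theorem bddAbove_image (hH : IsAdmissible Ω H) {x : X} (hx : x ∈ Ω) {ρ a p : ℝ} :
    BddAbove ((fun q => H x ρ q) '' {q | 0 ≤ q ∧ |q - p| ≤ a}) := by
  refine ⟨H x ρ (p + a), ?_⟩
  rintro _ ⟨q, hq, rfl⟩
  have h : q ≤ p + a := by linarith [le_of_abs_le hq.2]
  exact hH.monotoneOn hx ρ hq.1 (hq.1.trans h) h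

end IsAdmissible

theorem IsCoercive.exists_pos {X : Type*} {Ω : Set X} {H : X → ℝ → ℝ → ℝ}
    (hcoer : IsCoercive Ω H) {R : ℝ} (hR : 0 < R) :
    ∃ P : ℝ, 0 ≤ P ∧ ∀ p, P ≤ p → ∀ x ∈ Ω, ∀ ρ, |ρ| ≤ R → 0 < H x ρ p := by
  have h := (hcoer R hR).eventually (lt_mem_nhds (show (0 : EReal) < ⊤ from EReal.zero_lt_top))
  obtain ⟨P, hP⟩ := eventually_atTop.1 h
  refine ⟨max P 0, le_max_right _ _, fun p hp x hx ρ hρ => ?_⟩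
  have h1 := hP p ((le_max_left _ _).trans hp)
  have h2 : (0 : EReal) < (H x ρ p : EReal) :=
    h1.trans_le ((iInf₂_le x hx).trans (iInf₂_le ρ (abs_le.1 hρ)))
  exact_mod_cast h2

/-! ### Monge solutions are s-solutions. -/

theorem IsMongeSubsolution.isSSubsolution (hΩ : IsOpen Ω) (hH : IsAdmissible Ω H)
    (hu : IsMongeSubsolution Ω H u) : IsSSubsolution Ω H u := by
  refine ⟨hu.1.continuousOn.upperSemicontinuousOn, fun ψ₁ ψ₂ h₁ h₂ x hx hmax => ?_⟩
  rw [IsLocalMaxOn, IsMaxFilter, hΩ.nhdsWithin_eq hx] at hmax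
  have h : slope ψ₁ x ≤ subSlope u x + slope ψ₂ x := by
    rw [← h₁.2.1 x hx]
    refine subSlope_le_of_eventually (add_nonneg (subSlope_nonneg _ _) (slope_nonneg _ _))
      fun η hη => ?_
    filter_upwards [eventually_sub_le_subSlope hΩ hu.1 hx (half_pos hη),
      eventually_abs_sub_le_slope hΩ h₂ hx (half_pos hη), nhdsWithin_le_nhds hmax] with y h1 h2 h3
    have := le_of_abs_le h2
    linarith
  have ha := slope_le_slopeUpper hΩ h₂ hx
  have ha0 := (slope_nonneg ψ₂ x).trans ha
  have hp := slope_nonneg ψ₁ x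
  -- The witness is the lowest momentum in the window, clipped at `0`; by `h` it does not exceed the
  -- sub-slope.
  refine (csInf_le (hH.bddBelow_image hx _ _ _)
    ⟨max (slope ψ₁ x - slopeUpper ψ₂ x) 0, ⟨le_max_right _ _, ?_⟩, rfl⟩).trans ?_
  · rw [abs_le]
    constructor
    · linarith [le_max_left (slope ψ₁ x - slopeUpper ψ₂ x) 0]
    · linarith [max_le (a := slope ψ₁ x - slopeUpper ψ₂ x) (b := 0)
        (c := slope ψ₁ x + slopeUpper ψ₂ x) (by linarith) (by linarith)]
  · exact (hH.monotoneOn hx _ (mem_Ici.2 (le_max_right _ _)) (subSlope_nonneg u x)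
      (max_le (by linarith) (subSlope_nonneg u x))).trans (hu.2 x hx)

theorem IsMongeSupersolution.isSSupersolution (hΩ : IsOpen Ω) (hH : IsAdmissible Ω H)
    (hu : IsMongeSupersolution Ω H u) : IsSSupersolution Ω H u := by
  refine ⟨hu.1.continuousOn.lowerSemicontinuousOn, fun ψ₁ ψ₂ h₁ h₂ x hx hmin => ?_⟩
  rw [IsLocalMinOn, IsMinFilter, hΩ.nhdsWithin_eq hx] at hmin
  have h : subSlope u x ≤ slope ψ₁ x + slope ψ₂ x := by
    refine subSlope_le_of_eventually (add_nonneg (slope_nonneg _ _) (slope_nonneg _ _))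
      fun η hη => ?_
    filter_upwards [eventually_abs_sub_le_slope hΩ h₁.1 hx (half_pos hη),
      eventually_abs_sub_le_slope hΩ h₂ hx (half_pos hη), nhdsWithin_le_nhds hmin] with y h1 h2 h3
    have := neg_le_of_abs_le h1
    have := neg_le_of_abs_le h2
    linarith
  have ha := slope_le_slopeUpper hΩ h₂ hx
  have ha0 := (slope_nonneg ψ₂ x).trans ha
  have hp := slope_nonneg ψ₁ x
  -- The witness is the top of the window, which dominates the sub-slope.
  refine le_trans ?_ (le_csSup (hH.bddAbove_image hx)
    ⟨slope ψ₁ x + slopeUpper ψ₂ x, ⟨by positivity, ?_⟩, rfl⟩)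
  · exact (hu.2 x hx).trans (hH.monotoneOn hx _ (subSlope_nonneg u x) (add_nonneg hp ha0)
      (by linarith))
  · rw [add_sub_cancel_left, abs_of_nonneg ha0]

/-! ### s-subsolutions are locally Lipschitz Monge subsolutions. -/

/-- On the sphere of radius `r` the term `K t²` exceeds `2R`, the largest possible oscillation of
`u`, so the centre beats the sphere and the maximum is interior. -/
theorem IsSSubsolution.exists_max_profile [ProperSpace X] (hX : IsGeodesicSpace X)
    (hc : ContinuousOn u Ω) (hu : IsSSubsolution Ω H u) {z : X} {r R M ε K : ℝ} (hr : 0 < r)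
    (hball : Metric.closedBall z r ⊆ Ω) (hR : ∀ y ∈ Metric.closedBall z r, |u y| ≤ R)
    (hM : 0 ≤ M) (hε : 0 < ε) (hK : 2 * R < K * r ^ 2) :
    ∃ w ∈ Metric.ball z r, H w (u w) (profileDeriv M ε K (dist z w)) ≤ 0 ∧
      ∀ y ∈ Metric.closedBall z r,
        u y - profile M ε K (dist z y) ≤ u w - profile M ε K (dist z w) := by
  have hz : z ∈ Metric.closedBall z r := Metric.mem_closedBall_self hr.le
  have hR0 : 0 ≤ R := (abs_nonneg _).trans (hR z hz)
  have hK0 : 0 ≤ K := by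
    by_contra! h
    nlinarith [sq_nonneg r]
  have hψ := lowerTestClass_profile hX hM hε hK0 z Ω
  obtain ⟨w, hw, hmax⟩ := (isCompact_closedBall z r).exists_isMaxOn ⟨z, hz⟩
    ((hc.sub hψ.1.continuousOn).mono hball)
  have hmax' : ∀ y ∈ Metric.closedBall z r,
      u y - profile M ε K (dist z y) ≤ u w - profile M ε K (dist z w) := fun y hy => hmax hy
  have hwr : w ∈ Metric.ball z r := by
    rw [Metric.mem_ball]
    refine lt_of_le_of_ne (Metric.mem_closedBall.1 hw) fun he => ?_
    have h1 := hmax' z hz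
    rw [dist_self, profile_zero hε, dist_comm z w, he] at h1
    have h2 := mul_sq_le_profile (K := K) hM hε hr.le
    have h3 := abs_le.1 (hR z hz)
    have h4 := abs_le.1 (hR w hw)
    linarith
  refine ⟨w, hwr, ?_, hmax'⟩
  have := hu.le_zero_of_isLocalMaxOn hψ (hball hw) (IsLocalMax.on
    (f := fun y => u y - profile M ε K (dist z y)) (hmax.isLocalMax (mem_of_superset (Metric.isOpen_ball.mem_nhds hwr) Metric.ball_subset_closedBall)) Ω)
  rwa [slope_profile hX hM hε hK0] at this

theorem IsSSubsolution.sub_le_of_pos [ProperSpace X] (hX : IsGeodesicSpace X)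
    (hc : ContinuousOn u Ω) (hu : IsSSubsolution Ω H u) {z : X} {r R m M K : ℝ} (hr : 0 < r)
    (hball : Metric.closedBall z r ⊆ Ω) (hR : ∀ y ∈ Metric.closedBall z r, |u y| ≤ R)
    (hm : 0 ≤ m) (hmM : m < M) (hK : 2 * R < K * r ^ 2)
    (hpos : ∀ y ∈ Metric.closedBall z r, ∀ q, m ≤ q → 0 < H y (u y) q) {y : X}
    (hy : y ∈ Metric.closedBall z r) : u y - u z ≤ M * dist z y + K * dist z y ^ 2 := by
  have hM : 0 < M := hm.trans_lt hmM
  have hz : z ∈ Metric.closedBall z r := Metric.mem_closedBall_self hr.le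
  have hR0 : 0 ≤ R := (abs_nonneg _).trans (hR z hz)
  have hK0 : 0 ≤ K := by
    by_contra! h
    nlinarith [sq_nonneg r]
  refine le_of_forall_pos_le_add fun η hη => ?_
  obtain ⟨δ, hδ, hδu⟩ := Metric.continuousOn_iff.1 (hc.mono hball) z hz η hη
  -- With `c = 1 - m / M` the slope beyond distance `δ` is at least `M (1 - c) = m`, where `H > 0`;
  -- hence the maximum point is within `δ` of `z`.
  have hc0 : 0 < 1 - m / M := sub_pos.2 ((div_lt_one hM).2 hmM)
  have hc1 : 1 - m / M ≤ 1 := by linarith [div_nonneg hm hM.le]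
  obtain ⟨w, hw, hHw, hmax⟩ := hu.exists_max_profile hX hc hr hball hR hM.le (mul_pos hδ hc0) hK
  have hwδ : dist z w < δ := by
    by_contra! h
    refine (hpos w (Metric.ball_subset_closedBall hw) _ ?_).not_ge hHw
    refine le_trans (le_of_eq ?_) (le_profileDeriv hM.le hc0 hc1 hδ hK0 h)
    field_simp
    ring
  have h1 := hδu w (Metric.ball_subset_closedBall hw) (by rwa [dist_comm])
  have h2 := hmax y hy
  have h3 := profile_nonneg hM.le (mul_pos hδ hc0) hK0 (dist_nonneg (x := z) (y := w))
  have h4 := profile_le (K := K) hM.le (mul_pos hδ hc0) (dist_nonneg (x := z) (y := y))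
  rw [Real.dist_eq] at h1
  have h5 := le_of_abs_le h1.le
  linarith

theorem exists_closedBall_subset_abs_le [ProperSpace X] (hc : ContinuousOn u Ω) {x : X} {s : Set X}
    (hs : s ∈ 𝓝 x) (hsΩ : s ⊆ Ω) :
    ∃ r > 0, ∃ R > 0, ∀ z ∈ Metric.ball x r, Metric.closedBall z r ⊆ s ∧
      ∀ y ∈ Metric.closedBall z r, |u y| ≤ R := by
  obtain ⟨r, hr, hrs⟩ := Metric.nhds_basis_closedBall.mem_iff.1 hs
  obtain ⟨R, hR⟩ := (isCompact_closedBall x r).exists_bound_of_continuousOn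
    (hc.mono (hrs.trans hsΩ))
  have hsub : ∀ z ∈ Metric.ball x (r / 2), Metric.closedBall z (r / 2) ⊆ Metric.closedBall x r :=
    fun z hz => Metric.closedBall_subset_closedBall' (by
      rw [Metric.mem_ball] at hz
      linarith)
  exact ⟨r / 2, half_pos hr, max R 1, by positivity, fun z hz => ⟨(hsub z hz).trans hrs,
    fun y hy => (hR y (hsub z hz hy)).trans (le_max_left _ _)⟩⟩

/-- The coercivity threshold and the bound on `u` are uniform over nearby centres, so exchanging
centre and evaluation point yields a two-sided estimate. -/
theorem IsSSubsolution.locallyLipschitzOn [ProperSpace X] (hX : IsGeodesicSpace X)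
    (hΩ : IsOpen Ω) (hcoer : IsCoercive Ω H) (hc : ContinuousOn u Ω)
    (hu : IsSSubsolution Ω H u) : LocallyLipschitzOn Ω u := by
  intro x hx
  obtain ⟨r, hr, R, hR, h⟩ := exists_closedBall_subset_abs_le hc (hΩ.mem_nhds hx) Subset.rfl
  obtain ⟨P, hP, hpos⟩ := hcoer.exists_pos hR
  set K := (2 * R + 1) / r ^ 2 with hKdef
  have hK0 : 0 ≤ K := by positivity
  have hK : 2 * R < K * r ^ 2 := by
    rw [hKdef, div_mul_cancel₀ _ (by positivity)]
    linarith
  refine ⟨Real.toNNReal (P + 1 + K * r), Metric.ball x (r / 2),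
    nhdsWithin_le_nhds (Metric.ball_mem_nhds x (half_pos hr)), ?_⟩
  have key : ∀ y ∈ Metric.ball x (r / 2), ∀ z ∈ Metric.ball x (r / 2),
      u y - u z ≤ (P + 1 + K * r) * dist y z := by
    intro y hy z hz
    have hd : dist z y ≤ r := by
      have := dist_triangle_right z y x
      rw [Metric.mem_ball] at hy hz
      linarith
    obtain ⟨hb, hRz⟩ := h z (Metric.ball_subset_ball (by linarith) hz)
    have := hu.sub_le_of_pos hX hc hr hb hRz hP (lt_add_one P) hK
      (fun w hw q hq => hpos q hq w (hb hw) _ (hRz w hw)) (Metric.mem_closedBall'.2 hd)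
    rw [dist_comm y z]
    nlinarith [mul_le_mul_of_nonneg_left hd (mul_nonneg hK0 (dist_nonneg (x := z) (y := y)))]
  refine LipschitzOnWith.of_dist_le_mul fun y hy z hz => ?_
  rw [Real.coe_toNNReal _ (by positivity), Real.dist_eq, abs_le]
  have h1 := key y hy z hz
  have h2 := key z hz y hy
  rw [dist_comm] at h2
  constructor <;> linarith

theorem IsSSubsolution.isMongeSubsolution [ProperSpace X] (hX : IsGeodesicSpace X)
    (hΩ : IsOpen Ω) (hH : IsAdmissible Ω H) (hcoer : IsCoercive Ω H) (hc : ContinuousOn u Ω)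
    (hu : IsSSubsolution Ω H u) : IsMongeSubsolution Ω H u := by
  refine ⟨hu.locallyLipschitzOn hX hΩ hcoer hc, fun x hx => ?_⟩
  by_contra! hpos
  have near : ∀ m, 0 ≤ m → 0 < H x (u x) m → ∃ r > 0, ∃ R > 0, ∃ K : ℝ, 2 * R < K * r ^ 2 ∧
      ∀ z ∈ Metric.ball x r, Metric.closedBall z r ⊆ Ω ∧
        (∀ y ∈ Metric.closedBall z r, |u y| ≤ R) ∧
        ∀ y ∈ Metric.closedBall z r, ∀ q, m ≤ q → 0 < H y (u y) q := by
    intro m hm hxm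
    have hev : ∀ᶠ y in 𝓝 x, 0 < H y (u y) m :=
      ((hH.continuousOn_comp hc hm).continuousAt (hΩ.mem_nhds hx)).eventually (lt_mem_nhds hxm)
    obtain ⟨r, hr, R, hR, h⟩ := exists_closedBall_subset_abs_le hc
      (inter_mem (hΩ.mem_nhds hx) hev) inter_subset_left
    refine ⟨r, hr, R, hR, (2 * R + 1) / r ^ 2, ?_, fun z hz => ⟨fun y hy => ((h z hz).1 hy).1,
      (h z hz).2, fun y hy q hq => ?_⟩⟩
    · rw [div_mul_cancel₀ _ (by positivity)]
      linarith
    · have hy' := (h z hz).1 hy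
      exact lt_of_lt_of_le hy'.2 (hH.monotoneOn hy'.1 _ hm (hm.trans hq) hq)
  -- If the sub-slope is `0` no smaller momentum exists, but then `H > 0` near `x` at every
  -- momentum, so the mere existence of a touching point (with `M = 0`) is absurd.
  rcases (subSlope_nonneg u x).eq_or_lt with h0 | h0
  · rw [← h0] at hpos
    obtain ⟨r, hr, R, hR, K, hK, h⟩ := near 0 le_rfl hpos
    obtain ⟨hb, hRx, hp⟩ := h x (Metric.mem_ball_self hr)
    obtain ⟨w, hw, hHw, -⟩ := hu.exists_max_profile hX hc hr hb hRx le_rfl one_pos hK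
    have hK0 : 0 ≤ K := by
      by_contra! h
      nlinarith [sq_nonneg r]
    exact (hp w (Metric.ball_subset_closedBall hw) _
      (profileDeriv_nonneg le_rfl one_pos hK0 dist_nonneg)).not_ge hHw
  · obtain ⟨m, ⟨hm0, hmp⟩, hm⟩ : ∃ m, m ∈ Ioo 0 (subSlope u x) ∧ 0 < H x (u x) m := by
      have hca := (hH.continuousOn_momentum hx (u x)).continuousAt (Ici_mem_nhds h0)
      have h1 := nhdsWithin_le_nhds (s := Iio (subSlope u x))
        (hca.eventually (lt_mem_nhds hpos))
      exact (Eventually.and (Ioo_mem_nhdsLT h0) h1).exists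
    obtain ⟨r, hr, R, hR, K, hK, h⟩ := near m hm0.le hm
    obtain ⟨M, hmM, hMp⟩ := exists_between hmp
    refine hMp.not_ge (subSlope_le_of_eventually (hm0.trans hmM).le fun η hη => ?_)
    -- Near `x` the quadratic term is absorbed into `η * dist x z`.
    have hK' : Tendsto (fun z => K * dist x z) (𝓝 x) (𝓝 0) := by
      have : Tendsto (fun z => K * dist x z) (𝓝 x) (𝓝 (K * dist x x)) :=
        (continuous_const.mul (continuous_const.dist continuous_id)).tendsto x
      rwa [dist_self, mul_zero] at this
    refine nhdsWithin_le_nhds ?_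
    filter_upwards [hK'.eventually (gt_mem_nhds hη), Metric.ball_mem_nhds x hr] with z hz hzr
    obtain ⟨hb, hRz, hp⟩ := h z hzr
    have := hu.sub_le_of_pos hX hc hr hb hRz hm0.le hmM hK hp
      (y := x) (Metric.mem_closedBall'.2 (Metric.mem_ball.1 hzr).le)
    rw [dist_comm z x] at this
    nlinarith [mul_le_mul_of_nonneg_right hz.le (dist_nonneg (x := x) (y := z))]

/-! ### s-supersolutions, and the equivalence. -/

theorem IsSSupersolution.zero_le [ProperSpace X] (hX : IsGeodesicSpace X)
    (hΩ : IsOpen Ω) (hH : IsAdmissible Ω H) (hlip : LocallyLipschitzOn Ω u)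
    (hu : IsSSupersolution Ω H u) {x : X} (hx : x ∈ Ω) : 0 ≤ H x (u x) (subSlope u x) := by
  have hc : ContinuousOn u Ω := hlip.continuousOn
  by_contra! hneg
  have h0 := subSlope_nonneg u x
  obtain ⟨M, hpM, hM⟩ : ∃ M, subSlope u x < M ∧ H x (u x) M < 0 := by
    have h1 := ((hH.continuousOn_momentum hx (u x)) _ h0).eventually (gt_mem_nhds hneg)
    have h2 := nhdsWithin_mono _
      (show Ioi (subSlope u x) ⊆ Ici 0 from fun q hq => h0.trans (le_of_lt hq)) h1
    exact (Eventually.and (self_mem_nhdsWithin : Ioi (subSlope u x) ∈ 𝓝[>] subSlope u x) h2).exists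
  have hM0 : 0 < M := h0.trans_lt hpM
  obtain ⟨M', hpM', hM'M⟩ := exists_between hpM
  have hev : ∀ᶠ y in 𝓝 x, H y (u y) M < 0 :=
    ((hH.continuousOn_comp hc hM0.le).continuousAt (hΩ.mem_nhds hx)).eventually (gt_mem_nhds hM)
  have hev2 : ∀ᶠ y in 𝓝 x, u x - u y ≤ M' * dist x y := by
    have h1 := eventually_sub_le_subSlope hΩ hlip hx (sub_pos.2 hpM')
    rw [eventually_nhdsWithin_iff] at h1
    filter_upwards [h1] with y hy
    rcases eq_or_ne y x with rfl | hne
    · simp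
    · have := hy hne
      rwa [add_sub_cancel] at this
  obtain ⟨r, hr, hrs⟩ := Metric.nhds_basis_closedBall.mem_iff.1
    (inter_mem (hΩ.mem_nhds hx) (inter_mem hev hev2))
  -- This makes `M (r - ε) > M' r`: on the sphere the cone rises more than `u` can drop, so the
  -- minimum of `u` plus the cone is interior.
  obtain ⟨ε, hε, hεr⟩ : ∃ ε > 0, M * ε < (M - M') * r :=
    ⟨(M - M') * r / (2 * M), by have := sub_pos.2 hM'M; positivity, by
      have : 0 < (M - M') * r := mul_pos (sub_pos.2 hM'M) hr
      field_simp
      linarith⟩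
  have hψ := lowerTestClass_profile hX hM0.le hε (le_refl 0) x Ω
  have hxr : x ∈ Metric.closedBall x r := Metric.mem_closedBall_self hr.le
  obtain ⟨w, hw, hmin⟩ := (isCompact_closedBall x r).exists_isMinOn ⟨x, hxr⟩
    ((hc.sub hψ.neg.1.continuousOn).mono fun y hy => (hrs hy).1)
  have hwr : w ∈ Metric.ball x r := by
    rw [Metric.mem_ball]
    refine lt_of_le_of_ne (Metric.mem_closedBall.1 hw) fun he => ?_
    have h1 : u w - -profile M ε 0 (dist x w) ≤ u x - -profile M ε 0 (dist x x) := hmin hxr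
    have h2 : u x - u w ≤ M' * dist x w := (hrs hw).2.2
    rw [dist_comm] at he
    rw [dist_self, profile_zero hε, he] at h1
    rw [he] at h2
    have h3 := mul_sub_le_profile hM0.le hε (le_refl 0) hr.le
    linarith
  have hwΩ : w ∈ Ω := (hrs hw).1
  have h1 := hu.zero_le_of_isLocalMinOn hψ.neg hwΩ (IsLocalMin.on
    (f := fun y => u y - -profile M ε 0 (dist x y)) (hmin.isLocalMin (mem_of_superset (Metric.isOpen_ball.mem_nhds hwr) Metric.ball_subset_closedBall)) Ω)
  rw [slope_neg, slope_profile hX hM0.le hε le_rfl] at h1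
  have h2 : H w (u w) M < 0 := (hrs hw).2.1
  exact (h1.trans (hH.monotoneOn hwΩ _ (profileDeriv_nonneg hM0.le hε le_rfl dist_nonneg) hM0.le
    (profileDeriv_le hM0.le))).not_gt h2

theorem isMongeSolution_iff_isSSolution [ProperSpace X] (hX : IsGeodesicSpace X)
    (hΩ : IsOpen Ω) (hH : IsAdmissible Ω H) (hcoer : IsCoercive Ω H) :
    IsMongeSolution Ω H u ↔ IsSSolution Ω H u := by
  refine ⟨fun h => ⟨h.1.1.continuousOn, h.1.isSSubsolution hΩ hH, h.2.isSSupersolution hΩ hH⟩,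
    fun h => ?_⟩
  -- The subsolution half comes first: it provides the Lipschitz bound that the supersolution half
  -- assumes.
  have hsub := h.2.1.isMongeSubsolution hX hΩ hH hcoer h.1
  exact ⟨hsub, hsub.1, fun x hx => h.2.2.zero_le hX hΩ hH hsub.1 hx⟩

end MetricHJ

/-- Functions on `Ω` (and on `Ω × ℝ × [0, ∞)`) are represented by total functions; only their values
on `Ω` (and on `Ω × ℝ × [0, ∞)`) matter. -/
theorem theorem4p10 {X : Type*} [MetricSpace X] [CompleteSpace X] [ProperSpace X]
    (hX : MetricHJ.IsGeodesicSpace X) (Ω : Set X) (hΩ : IsOpen Ω)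
    (H : X → ℝ → ℝ → ℝ)
    (hcont : ContinuousOn (fun z : X × ℝ × ℝ => H z.1 z.2.1 z.2.2)
      (Ω ×ˢ (Set.univ : Set ℝ) ×ˢ Set.Ici (0 : ℝ)))
    (hcoer : MetricHJ.IsCoercive Ω H)
    (hmono : ∀ x ∈ Ω, ∀ ρ : ℝ, StrictMonoOn (fun p : ℝ => H x ρ p) (Set.Ioi 0))
    (u : X → ℝ) :
    (MetricHJ.IsMongeSolution Ω H u ↔ MetricHJ.IsSSolution Ω H u) ∧
      (MetricHJ.IsMongeSolution Ω H u ∨ MetricHJ.IsSSolution Ω H u →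
        LocallyLipschitzOn Ω u) := by
  have h := MetricHJ.isMongeSolution_iff_isSSolution (u := u) hX hΩ ⟨hcont, hmono⟩ hcoer
  exact ⟨h, fun hu => (hu.elim id h.2).1.1⟩
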